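/- Let $0<\rho_0<1$ and $c_0>0$. There are constants $C_3,C_4>0$, depending only on $\rho_0$ and $c_0$, such that the following holds for all integers $n\ge 0$, $p\ge 1$ and all real $\gamma\ge 1$, $\tau\ge 1$. Let $\varepsilon_{ij}$, $i\in\mathbb Z$, $1\le j\le p$, be i.i.d. real random variables with $\mathbb E\,\varepsilon_{ij}=0$ and $\mathbb E\exp(c_0|\varepsilon_{ij}|)=\theta<\infty$, and write $\boldsymbol\varepsilon_i=(\varepsilon_{i1},\dots,\varepsilon_{ip})^\top$. Let $\mu\in\mathbb R^p$, let $A_0=I_p$, and let $A_k$, $k\ge 1$, be real $p\times p$ matrices such that, in spectral norm, $$\|A_k\|=\sup_{x\ne 0}\frac{|A_kx|_2}{|x|_2}\le \gamma\,\rho_0^{k/\tau}\qquad\text{for all }k\ge 0 .$$ Let $X_i=\mu+\sum_{k=0}^\infty A_k\boldsymbol\varepsilon_{i-k}$, $i\in\mathbb Z$. Let $G:\mathbb R^p\to\mathbb R$ (not necessarily bounded) be such that for some $g_1,\dots,g_p\ge 0$ with $\sum_{j=1}^p g_j=1$, $$|G(u)-G(v)|\le\sum_{j=1}^p g_j|u_j-v_j|\qquad\text{for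 all }u,v\in\mathbb R^p .$$ Then for every $i$ the series defining $X_i$ converges absolutely almost surely, $G(X_i)$ is integrable, and for every $x>0$ $$\mathbb P\Big(\sum_{i=1}^n\big(G(X_i)-\mathbb E\,G(X_i)\big)\ge x\Big)\le 2\exp\Big\{-\frac{x^2}{C_3\,n\,\theta^2\tau^2\gamma^2+C_4\,\gamma\,\tau\,x}\Big\}.$$ -/

import Mathlib

open MeasureTheory ProbabilityTheory

/-- The spectral norm `sup_{x ≠ 0} |A x|₂ / |x|₂` of a real square matrix, i.e. the operator norm
of `A` acting on Euclidean space. -/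
noncomputable def spectralNorm2 {p : ℕ} (A : Matrix (Fin p) (Fin p) ℝ) : ℝ :=
  ‖Matrix.toEuclideanCLM (n := Fin p) (𝕜 := ℝ) A‖

/-- The innovations `ε i j`, `i ∈ ℤ`, `1 ≤ j ≤ p`, are independent and identically distributed
real random variables (jointly in time `i` and coordinate `j`). -/
structure IIDInnovations {Ω : Type*} [MeasurableSpace Ω] (P : Measure Ω) {p : ℕ}
    (ε : ℤ → Fin p → Ω → ℝ) : Prop where
  measurable : ∀ i j, Measurable (ε i j)
  indep : iIndepFun (fun q : ℤ × Fin p => ε q.1 q.2) P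
  identDistrib : ∀ i j i' j', IdentDistrib (ε i j) (ε i' j') P P

/-- The `k`-th term `A_k ε_{i-k}` of the moving-average expansion at time `i`. -/
def linearTerm {Ω : Type*} {p : ℕ} (A : ℕ → Matrix (Fin p) (Fin p) ℝ)
    (ε : ℤ → Fin p → Ω → ℝ) (i : ℤ) (ω : Ω) (k : ℕ) : Fin p → ℝ :=
  (A k).mulVec (fun j => ε (i - k) j ω)

/-- The linear process `X_i = m + ∑_{k ≥ 0} A_k ε_{i-k}`, as a function of the outcome `ω`. -/
noncomputable def linearProcess {Ω : Type*} {p : ℕ} (m : Fin p → ℝ)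
    (A : ℕ → Matrix (Fin p) (Fin p) ℝ) (ε : ℤ → Fin p → Ω → ℝ) (i : ℤ) (ω : Ω) : Fin p → ℝ :=
  m + ∑' k : ℕ, linearTerm A ε i ω k

/-- `G` is Lipschitz with respect to a weighted `ℓ¹` distance whose weights are nonnegative
and sum to one. -/
def WeightedLipschitz {p : ℕ} (G : (Fin p → ℝ) → ℝ) : Prop :=
  ∃ g : Fin p → ℝ, (∀ j, 0 ≤ g j) ∧ ∑ j, g j = 1 ∧
    ∀ u v : Fin p → ℝ, |G u - G v| ≤ ∑ j, g j * |u j - v j|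

theorem Real.exp_le_one_add_self_add_sq_mul_exp_abs (x : ℝ) :
    Real.exp x ≤ 1 + x + x ^ 2 * Real.exp |x| := by
  have h := Complex.norm_exp_sub_sum_le_norm_mul_exp (x : ℂ) 2
  have e : Complex.exp (x : ℂ) - ∑ m ∈ Finset.range 2, (x : ℂ) ^ m / (m.factorial : ℂ)
      = ((Real.exp x - (1 + x) : ℝ) : ℂ) := by
    simp [Finset.sum_range_succ]
  rw [e, Complex.norm_real, Complex.norm_real, Real.norm_eq_abs, Real.norm_eq_abs, sq_abs] at h
  linarith [le_abs_self (Real.exp x - (1 + x))]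

theorem Real.sq_mul_exp_half_le {c w : ℝ} (hc : 0 < c) (hw : 0 ≤ w) :
    w ^ 2 * Real.exp (c / 2 * w) ≤ 8 / c ^ 2 * Real.exp (c * w) := by
  have h := Real.quadratic_le_exp_of_nonneg (x := c / 2 * w) (by positivity)
  have h0 : 0 ≤ c / 2 * w := by positivity
  have h1 : w ^ 2 ≤ 8 / c ^ 2 * Real.exp (c / 2 * w) := by
    rw [div_mul_eq_mul_div, le_div_iff₀ (by positivity)]
    nlinarith
  have h2 : Real.exp (c * w) = Real.exp (c / 2 * w) * Real.exp (c / 2 * w) := by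
    rw [← Real.exp_add]; ring_nf
  rw [h2, ← mul_assoc]
  gcongr

theorem integrable_abs_of_integrable_exp {Ω : Type*} [MeasurableSpace Ω] {P : Measure Ω}
    {Y : Ω → ℝ} (hY : AEStronglyMeasurable Y P) {c : ℝ} (hc : 0 < c)
    (h : Integrable (fun ω => Real.exp (c * |Y ω|)) P) : Integrable (fun ω => |Y ω|) P := by
  refine (h.div_const c).mono' (by simpa using hY.norm) (.of_forall fun ω => ?_)
  rw [Real.norm_eq_abs, abs_abs, le_div_iff₀ hc]
  linarith [Real.add_one_le_exp (c * |Y ω|)]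

/-- Exponential moment bound for a centred Lipschitz function of one real random variable. -/
theorem lintegral_exp_lipschitz_sub_integral_le (μ : Measure ℝ) [IsProbabilityMeasure μ]
    {c θ L l : ℝ} {f : ℝ → ℝ} (hc : 0 < c)
    (hint : Integrable (fun y => Real.exp (c * |y|)) μ)
    (hθ : ∫ y, Real.exp (c * |y|) ∂μ ≤ θ) (hL : 0 ≤ L)
    (hf : ∀ y y', |f y - f y'| ≤ L * |y - y'|) (hl : 0 ≤ l) (hlL : l * L ≤ c / 2) :
    ∫⁻ y, ENNReal.ofReal (Real.exp (l * (f y - ∫ z, f z ∂μ))) ∂μ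
      ≤ ENNReal.ofReal (Real.exp (8 * (θ / c) ^ 2 * l ^ 2 * L ^ 2)) := by
  have hlip : LipschitzWith L.toNNReal f := LipschitzWith.of_dist_le_mul fun y y' => by
    simpa [Real.dist_eq, Real.coe_toNNReal L hL] using hf y y'
  have hfm : AEStronglyMeasurable f μ := hlip.continuous.aestronglyMeasurable
  have habs : Integrable (fun y : ℝ => |y|) μ :=
    integrable_abs_of_integrable_exp (Y := fun y => y)
      measurable_id.aestronglyMeasurable hc hint
  have hfint : Integrable f μ := by
    have hb : Integrable (fun y => |f 0| + L * |y|) μ :=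
      (integrable_const _).add (habs.const_mul L)
    refine hb.mono' hfm (.of_forall fun y => ?_)
    have h1 := hf y 0
    rw [sub_zero] at h1
    have h2 := abs_sub_abs_le_abs_sub (f y) (f 0)
    rw [Real.norm_eq_abs]; linarith
  set M := ∫ y, |y| ∂μ with hM
  have hM0 : 0 ≤ M := integral_nonneg fun y => abs_nonneg y
  have hexpM : Real.exp (c * M) ≤ θ := by
    refine le_trans ?_ hθ
    have := convexOn_exp.map_integral_le (μ := μ) (f := fun y : ℝ => c * |y|)
      Real.continuous_exp.continuousOn isClosed_univ (by simp) (habs.const_mul c) hint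
    rwa [integral_const_mul] at this
  have hD : ∀ y, |f y - ∫ z, f z ∂μ| ≤ L * (|y| + M) := by
    intro y
    have e : f y - ∫ z, f z ∂μ = ∫ z, (f y - f z) ∂μ := by
      rw [integral_sub (integrable_const _) hfint]; simp
    rw [e]
    calc |∫ z, (f y - f z) ∂μ| ≤ ∫ z, |f y - f z| ∂μ := abs_integral_le_integral_abs
      _ ≤ ∫ z, L * (|y| + |z|) ∂μ := by
        refine integral_mono ((integrable_const _).sub hfint).abs
          (((integrable_const _).add habs).const_mul _) fun z => ?_
        exact (hf y z).trans (mul_le_mul_of_nonneg_left (abs_sub _ _) hL)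
      _ = L * (|y| + M) := by
        rw [integral_const_mul, integral_add (integrable_const _) habs]; simp [hM]
  set K := 8 / c ^ 2 * (l * L) ^ 2 * Real.exp (c * M) with hK
  have hK0 : 0 ≤ K := by positivity
  have hpt : ∀ y, Real.exp (l * (f y - ∫ z, f z ∂μ)) ≤
      1 + l * (f y - ∫ z, f z ∂μ) + K * Real.exp (c * |y|) := by
    intro y
    set D := f y - ∫ z, f z ∂μ with hDdef
    have hw : 0 ≤ |y| + M := by positivity
    have h1 : |l * D| ≤ l * L * (|y| + M) := by
      rw [abs_mul, abs_of_nonneg hl, mul_assoc]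
      exact mul_le_mul_of_nonneg_left (hD y) hl
    have h2 : (l * D) ^ 2 * Real.exp |l * D| ≤ K * Real.exp (c * |y|) := by
      calc (l * D) ^ 2 * Real.exp |l * D|
          = |l * D| ^ 2 * Real.exp |l * D| := by rw [sq_abs]
        _ ≤ (l * L * (|y| + M)) ^ 2 * Real.exp (c / 2 * (|y| + M)) := by
            gcongr
            exact h1.trans (mul_le_mul_of_nonneg_right hlL hw)
        _ = (l * L) ^ 2 * ((|y| + M) ^ 2 * Real.exp (c / 2 * (|y| + M))) := by ring
        _ ≤ (l * L) ^ 2 * (8 / c ^ 2 * Real.exp (c * (|y| + M))) := by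
            exact mul_le_mul_of_nonneg_left (Real.sq_mul_exp_half_le hc hw) (sq_nonneg _)
        _ = K * Real.exp (c * |y|) := by
            rw [mul_add, Real.exp_add, hK]; ring
    linarith [Real.exp_le_one_add_self_add_sq_mul_exp_abs (l * D)]
  have hi1 : Integrable (fun y => l * (f y - ∫ z, f z ∂μ)) μ :=
    (hfint.sub (integrable_const _)).const_mul l
  have hbi : Integrable (fun y => 1 + l * (f y - ∫ z, f z ∂μ) + K * Real.exp (c * |y|)) μ :=
    ((integrable_const _).add hi1).add (hint.const_mul K)
  calc ∫⁻ y, ENNReal.ofReal (Real.exp (l * (f y - ∫ z, f z ∂μ))) ∂μ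
      ≤ ∫⁻ y, ENNReal.ofReal (1 + l * (f y - ∫ z, f z ∂μ) + K * Real.exp (c * |y|)) ∂μ :=
        lintegral_mono fun y => ENNReal.ofReal_le_ofReal (hpt y)
    _ = ENNReal.ofReal (∫ y, (1 + l * (f y - ∫ z, f z ∂μ) + K * Real.exp (c * |y|)) ∂μ) :=
        (ofReal_integral_eq_lintegral_ofReal hbi
          (.of_forall fun y => (Real.exp_pos _).le.trans (hpt y))).symm
    _ ≤ _ := by
        refine ENNReal.ofReal_le_ofReal ?_
        have hi2 : Integrable (fun y => 1 + l * (f y - ∫ z, f z ∂μ)) μ :=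
          (integrable_const _).add hi1
        rw [integral_add hi2 (hint.const_mul K), integral_add (integrable_const _) hi1, integral_const_mul, integral_const_mul,
          integral_sub hfint (integrable_const _)]
        simp only [integral_const, probReal_univ, smul_eq_mul, one_mul, sub_self, mul_zero,
          add_zero]
        have h3 : K * ∫ y, Real.exp (c * |y|) ∂μ ≤ 8 * (θ / c) ^ 2 * l ^ 2 * L ^ 2 := by
          have hI : 0 ≤ ∫ y, Real.exp (c * |y|) ∂μ := integral_nonneg fun y => (Real.exp_pos _).le
          calc K * ∫ y, Real.exp (c * |y|) ∂μ
              ≤ (8 / c ^ 2 * (l * L) ^ 2 * θ) * θ := by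
                have hθ0 : 0 ≤ θ := (Real.exp_pos _).le.trans hexpM
                rw [hK]; gcongr
            _ = _ := by field_simp
        linarith [Real.add_one_le_exp (8 * (θ / c) ^ 2 * l ^ 2 * L ^ 2)]

theorem continuous_of_abs_sub_le_sum {ι : Type*} [Fintype ι] {L : ι → ℝ} {F : (ι → ℝ) → ℝ}
    (hF : ∀ y y', |F y - F y'| ≤ ∑ q, L q * |y q - y' q|) : Continuous F := by
  rw [continuous_iff_continuousAt]
  intro y
  rw [ContinuousAt, tendsto_iff_dist_tendsto_zero]
  have h : Filter.Tendsto (fun z : ι → ℝ => ∑ q, L q * |z q - y q|) (nhds y) (nhds 0) := by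
    have : Continuous fun z : ι → ℝ => ∑ q, L q * |z q - y q| := by fun_prop
    simpa using this.tendsto y
  exact squeeze_zero (fun _ => dist_nonneg) (fun z => hF z y) h

theorem integrable_pi_of_abs_sub_le_sum {ι : Type*} [Fintype ι] {L : ι → ℝ} {F : (ι → ℝ) → ℝ}
    (μ : ι → Measure ℝ) [∀ q, IsProbabilityMeasure (μ q)]
    (habs : ∀ q, Integrable (fun y => |y|) (μ q))
    (hF : ∀ y y', |F y - F y'| ≤ ∑ q, L q * |y q - y' q|) : Integrable F (Measure.pi μ) := by
  have hb : Integrable (fun y : ι → ℝ => |F 0| + ∑ q, L q * |y q|) (Measure.pi μ) :=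
    (integrable_const _).add (integrable_finsetSum _ fun q _ =>
      (integrable_comp_eval (i := q) (habs q)).const_mul (L q))
  refine hb.mono' (continuous_of_abs_sub_le_sum hF).aestronglyMeasurable (.of_forall fun y => ?_)
  have h1 := hF y 0
  have h2 := abs_sub_abs_le_abs_sub (F y) (F 0)
  simp only [Pi.zero_apply, sub_zero] at h1
  rw [Real.norm_eq_abs]; linarith

/-- Exponential moment bound for a centred function of finitely many independent real random
variables which is Lipschitz in each of them. -/
theorem lintegral_pi_exp_lipschitz_sub_integral_le {c θ l : ℝ} (hc : 0 < c) (hl : 0 ≤ l) :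
    ∀ (d : ℕ) (μ : Fin d → Measure ℝ) [∀ q, IsProbabilityMeasure (μ q)]
      (L : Fin d → ℝ) (F : (Fin d → ℝ) → ℝ),
      (∀ q, Integrable (fun y => Real.exp (c * |y|)) (μ q)) →
      (∀ q, ∫ y, Real.exp (c * |y|) ∂(μ q) ≤ θ) → (∀ q, 0 ≤ L q) →
      (∀ y y', |F y - F y'| ≤ ∑ q, L q * |y q - y' q|) → (∀ q, l * L q ≤ c / 2) →
      ∫⁻ y, ENNReal.ofReal (Real.exp (l * (F y - ∫ z, F z ∂Measure.pi μ))) ∂Measure.pi μ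
        ≤ ENNReal.ofReal (Real.exp (8 * (θ / c) ^ 2 * l ^ 2 * ∑ q, L q ^ 2)) := by
  intro d
  induction d with
  | zero =>
    intro μ _ L F _ _ _ _ _
    have h : ∀ y : Fin 0 → ℝ, F y = F 0 := fun y => by rw [Subsingleton.elim y 0]
    simp [h]
  | succ d ih =>
    intro μ _ L F hint hθ hL hF hlL
    have habs : ∀ q, Integrable (fun y : ℝ => |y|) (μ q) := fun q =>
      integrable_abs_of_integrable_exp (Y := fun y => y)
        measurable_id.aestronglyMeasurable hc (hint q)
    have hFi := integrable_pi_of_abs_sub_le_sum μ habs hF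
    have hFc : Continuous F := continuous_of_abs_sub_le_sum hF
    set ν : Fin d → Measure ℝ := fun j => μ (Fin.succAbove 0 j) with hν
    have hmp := (measurePreserving_piFinSuccAbove μ 0).symm
    set e := (MeasurableEquiv.piFinSuccAbove (fun _ : Fin (d + 1) => ℝ) 0).symm with he
    have he' : ∀ x, e x = Fin.cons x.1 x.2 := fun x => by
      simp only [he, MeasurableEquiv.piFinSuccAbove_symm_apply]
      exact Fin.insertNth_zero' x.1 x.2
    have hcons : Continuous fun x : ℝ × (Fin d → ℝ) =>
        (Fin.cons x.1 x.2 : Fin (d + 1) → ℝ) := by fun_prop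
    have hF1 : ∀ a a' y, |F (Fin.cons a y) - F (Fin.cons a' y)| ≤ L 0 * |a - a'| := by
      intro a a' y
      simpa [Fin.sum_univ_succ] using hF (Fin.cons a y) (Fin.cons a' y)
    have hF2 : ∀ a y y', |F (Fin.cons a y) - F (Fin.cons a y')|
        ≤ ∑ j : Fin d, L j.succ * |y j - y' j| := by
      intro a y y'
      simpa [Fin.sum_univ_succ] using hF (Fin.cons a y) (Fin.cons a y')
    have hFprod : Integrable (fun x : ℝ × (Fin d → ℝ) => F (Fin.cons x.1 x.2))
        ((μ 0).prod (Measure.pi ν)) := by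
      have := hmp.integrable_comp_of_integrable hFi
      refine this.congr (.of_forall fun x => ?_)
      simp [he']
    have hsec : ∀ y, Integrable (fun a => F (Fin.cons a y)) (μ 0) := by
      intro y
      have hb : Integrable (fun a => |F (Fin.cons 0 y)| + L 0 * |a|) (μ 0) :=
        (integrable_const _).add ((habs 0).const_mul (L 0))
      refine hb.mono'
        (hFc.comp (by fun_prop)).aestronglyMeasurable (.of_forall fun a => ?_)
      have h1 := hF1 a 0 y
      have h2 := abs_sub_abs_le_abs_sub (F (Fin.cons a y)) (F (Fin.cons 0 y))
      rw [sub_zero] at h1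
      rw [Real.norm_eq_abs]; linarith
    set H : (Fin d → ℝ) → ℝ := fun y => ∫ a, F (Fin.cons a y) ∂(μ 0) with hH
    have hHlip : ∀ y y', |H y - H y'| ≤ ∑ j : Fin d, L j.succ * |y j - y' j| := by
      intro y y'
      rw [hH]
      simp only
      rw [← integral_sub (hsec y) (hsec y')]
      refine abs_integral_le_integral_abs.trans ?_
      calc _ ≤ ∫ _, (∑ j : Fin d, L j.succ * |y j - y' j|) ∂(μ 0) :=
            integral_mono ((hsec y).sub (hsec y')).abs (integrable_const _) fun a => hF2 a y y'
        _ = _ := by simp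
    have hHint : ∫ z, F z ∂Measure.pi μ = ∫ y, H y ∂Measure.pi ν := by
      rw [← hmp.integral_comp' (g := F)]
      simp only [he']
      exact integral_prod_symm _ hFprod
    have hIH := ih ν (fun j => L j.succ) H (fun j => hint _) (fun j => hθ _) (fun j => hL _)
      hHlip (fun j => hlL _)
    have hHc : Continuous H := continuous_of_abs_sub_le_sum hHlip
    set E := ∫ z, F z ∂Measure.pi μ with hE
    have hGm : Measurable fun y : Fin (d + 1) → ℝ =>
        ENNReal.ofReal (Real.exp (l * (F y - E))) := by
      have := hFc.measurable
      fun_prop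
    rw [← hmp.lintegral_comp hGm, lintegral_prod_symm _ (by
      have := hGm.comp e.measurable
      exact this.aemeasurable)]
    simp only [he']
    set κ := 8 * (θ / c) ^ 2 * l ^ 2 with hκ
    calc ∫⁻ y, ∫⁻ a, ENNReal.ofReal (Real.exp (l * (F (Fin.cons a y) - E))) ∂(μ 0) ∂Measure.pi ν
        = ∫⁻ y, (∫⁻ a, ENNReal.ofReal (Real.exp (l * (F (Fin.cons a y) - H y))) ∂(μ 0)) *
            ENNReal.ofReal (Real.exp (l * (H y - E))) ∂Measure.pi ν := by
          refine lintegral_congr fun y => ?_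
          rw [← lintegral_mul_const' _ _ ENNReal.ofReal_ne_top]
          refine lintegral_congr fun a => ?_
          rw [← ENNReal.ofReal_mul (Real.exp_pos _).le, ← Real.exp_add]
          ring_nf
      _ ≤ ∫⁻ y, ENNReal.ofReal (Real.exp (κ * L 0 ^ 2)) *
            ENNReal.ofReal (Real.exp (l * (H y - E))) ∂Measure.pi ν := by
          refine lintegral_mono fun y => ?_
          gcongr
          exact lintegral_exp_lipschitz_sub_integral_le (μ 0) hc (hint 0) (hθ 0) (hL 0)
            (f := fun a => F (Fin.cons a y)) (fun a a' => hF1 a a' y) hl (hlL 0)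
      _ = ENNReal.ofReal (Real.exp (κ * L 0 ^ 2)) *
            ∫⁻ y, ENNReal.ofReal (Real.exp (l * (H y - E))) ∂Measure.pi ν :=
          lintegral_const_mul' _ _ ENNReal.ofReal_ne_top
      _ ≤ ENNReal.ofReal (Real.exp (κ * L 0 ^ 2)) *
            ENNReal.ofReal (Real.exp (κ * ∑ j : Fin d, L j.succ ^ 2)) := by
          gcongr
          rw [hHint]; exact hIH
      _ = _ := by
          rw [← ENNReal.ofReal_mul (Real.exp_pos _).le, ← Real.exp_add, Fin.sum_univ_succ]
          ring_nf

theorem lintegral_exp_lipschitz_indep_le {Ω ι : Type*} [MeasurableSpace Ω] {P : Measure Ω}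
    [IsProbabilityMeasure P] {Y : ι → Ω → ℝ} (hYm : ∀ q, Measurable (Y q)) (hY : iIndepFun Y P)
    {c θ l : ℝ} (hc : 0 < c) (hl : 0 ≤ l)
    (hint : ∀ q, Integrable (fun ω => Real.exp (c * |Y q ω|)) P)
    (hθ : ∀ q, ∫ ω, Real.exp (c * |Y q ω|) ∂P ≤ θ)
    (T : Finset ι) {L : ι → ℝ} (hL : ∀ q, 0 ≤ L q) {F : (ι → ℝ) → ℝ}
    (hF : ∀ y y', |F y - F y'| ≤ ∑ q ∈ T, L q * |y q - y' q|) (hlL : ∀ q, l * L q ≤ c / 2) :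
    Measurable (fun ω => F fun q => Y q ω) ∧ Integrable (fun ω => F fun q => Y q ω) P ∧
    ∫⁻ ω, ENNReal.ofReal (Real.exp (l * (F (fun q => Y q ω) - ∫ ω', F (fun q => Y q ω') ∂P))) ∂P
      ≤ ENNReal.ofReal (Real.exp (8 * (θ / c) ^ 2 * l ^ 2 * ∑ q ∈ T, L q ^ 2)) := by
  classical
  set s := T.equivFin.symm with hs
  have hsum : ∀ f : ι → ℝ, ∑ q ∈ T, f q = ∑ j, f (s j) := fun f => by
    rw [← Finset.sum_coe_sort T f, ← Equiv.sum_comp s]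
  set ext : (Fin T.card → ℝ) → ι → ℝ :=
    fun y q => if h : q ∈ T then y (s.symm ⟨q, h⟩) else 0 with hext
  have hexts : ∀ y j, ext y (s j) = y j := fun y j => by simp [hext]
  set F' : (Fin T.card → ℝ) → ℝ := fun y => F (ext y) with hF'
  have hF'lip : ∀ y y', |F' y - F' y'| ≤ ∑ j, L (s j) * |y j - y' j| := by
    intro y y'
    refine (hF (ext y) (ext y')).trans (le_of_eq ?_)
    rw [hsum]
    simp only [hexts]
  set Z : Ω → Fin T.card → ℝ := fun ω j => Y (s j) ω with hZ
  have hZm : Measurable Z := measurable_pi_lambda _ fun j => hYm _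
  have hFZ : ∀ ω, F (fun q => Y q ω) = F' (Z ω) := by
    intro ω
    refine sub_eq_zero.mp (abs_nonpos_iff.mp ((hF _ _).trans (le_of_eq ?_)))
    rw [hsum]
    simp [hexts, hZ]
  have hmap : P.map Z = Measure.pi fun j => P.map (Y (s j)) :=
    (iIndepFun_iff_map_fun_eq_pi_map (f := fun j => Y (s j)) fun j => (hYm _).aemeasurable).mp
      (hY.precomp (g := fun j => (s j : ι)) (Subtype.val_injective.comp s.injective))
  have hprob : ∀ j, IsProbabilityMeasure (P.map (Y (s j))) := fun j =>
    Measure.isProbabilityMeasure_map (hYm _).aemeasurable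
  have hexpm : Measurable fun y : ℝ => Real.exp (c * |y|) := by fun_prop
  have hint' : ∀ j, Integrable (fun y => Real.exp (c * |y|)) (P.map (Y (s j))) := fun j =>
    (integrable_map_measure hexpm.aestronglyMeasurable (hYm _).aemeasurable).mpr (hint _)
  have hθ' : ∀ j, ∫ y, Real.exp (c * |y|) ∂(P.map (Y (s j))) ≤ θ := fun j => by
    rw [integral_map (hYm _).aemeasurable hexpm.aestronglyMeasurable]
    exact hθ _
  have hF'c : Continuous F' := continuous_of_abs_sub_le_sum hF'lip
  have hF'i : Integrable F' (P.map Z) := by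
    rw [hmap]
    refine integrable_pi_of_abs_sub_le_sum _ (fun j => ?_) hF'lip
    exact integrable_abs_of_integrable_exp (Y := fun y => y)
        measurable_id.aestronglyMeasurable hc (hint' j)
  simp only [hFZ]
  refine ⟨hF'c.measurable.comp hZm, hF'i.comp_measurable hZm, ?_⟩
  have key := lintegral_pi_exp_lipschitz_sub_integral_le (θ := θ) hc hl T.card
    (fun j => P.map (Y (s j))) (fun j => L (s j)) F' hint' hθ' (fun j => hL _) hF'lip
    (fun j => hlL _)
  rw [← hmap, integral_map hZm.aemeasurable hF'c.aestronglyMeasurable,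
    lintegral_map (by have := hF'c.measurable; fun_prop) hZm] at key
  rw [hsum]
  exact key

theorem measureReal_ge_le_exp_of_lintegral_exp_le {Ω : Type*} [MeasurableSpace Ω]
    {P : Measure Ω} {Z : Ω → ℝ} (hZ : AEMeasurable Z P) {V b x : ℝ}
    (hV : 0 ≤ V) (hb : 0 < b) (hx : 0 < x)
    (h : ∀ l, 0 ≤ l → l ≤ b →
      ∫⁻ ω, ENNReal.ofReal (Real.exp (l * Z ω)) ∂P ≤ ENNReal.ofReal (Real.exp (V * l ^ 2))) :
    P.real {ω | x ≤ Z ω} ≤ Real.exp (-(x ^ 2 / (4 * V + 2 * (x / b)))) := by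
  set D := 2 * V + x / b with hD
  have hxb : 0 < x / b := by positivity
  have hD0 : 0 < D := by positivity
  set l := x / D with hl
  have hl0 : 0 ≤ l := by positivity
  have hlD : l * D = x := by rw [hl]; field_simp
  have hlb : l ≤ b := by
    rw [hl, div_le_iff₀ hD0, hD]
    have : b * (x / b) = x := by field_simp
    nlinarith [mul_nonneg hb.le hV]
  have hlV : l * (2 * V) ≤ x := by
    have : 0 ≤ l * (x / b) := by positivity
    rw [hD] at hlD; nlinarith
  have h1 : P {ω | x ≤ Z ω} ≤ ENNReal.ofReal (Real.exp (-(l * x))) *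
      ∫⁻ ω, ENNReal.ofReal (Real.exp (l * Z ω)) ∂P := by
    rw [← lintegral_const_mul' _ _ ENNReal.ofReal_ne_top]
    refine meas_le_lintegral₀ (by fun_prop) fun ω hω => ?_
    rw [← ENNReal.ofReal_mul (Real.exp_pos _).le, ← Real.exp_add, ENNReal.one_le_ofReal,
      Real.one_le_exp_iff]
    have : l * x ≤ l * Z ω := mul_le_mul_of_nonneg_left hω hl0
    linarith
  have h2 : P {ω | x ≤ Z ω} ≤ ENNReal.ofReal (Real.exp (-(x ^ 2 / (4 * V + 2 * (x / b))))) := by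
    refine h1.trans ((mul_le_mul_right (h l hl0 hlb) _).trans ?_)
    rw [← ENNReal.ofReal_mul (Real.exp_pos _).le, ← Real.exp_add]
    refine ENNReal.ofReal_le_ofReal (Real.exp_le_exp.mpr ?_)
    have e : x ^ 2 / (4 * V + 2 * (x / b)) = l * x / 2 := by
      have : 4 * V + 2 * (x / b) = 2 * D := by rw [hD]; ring
      rw [this, hl]; field_simp
    rw [e]
    nlinarith [mul_le_mul_of_nonneg_left hlV hl0]
  exact ENNReal.toReal_le_of_le_ofReal (Real.exp_pos _).le h2

theorem ae_summable_and_integrable_tsum_of_nonneg {Ω : Type*} [MeasurableSpace Ω] {P : Measure Ω}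
    {f : ℕ → Ω → ℝ} (hf : ∀ k, Integrable (f k) P) (h0 : ∀ k ω, 0 ≤ f k ω)
    (hs : Summable fun k => ∫ ω, f k ω ∂P) :
    (∀ᵐ ω ∂P, Summable fun k => f k ω) ∧ Integrable (fun ω => ∑' k, f k ω) P := by
  have hm : ∀ k, AEMeasurable (fun ω => ENNReal.ofReal (f k ω)) P := fun k =>
    (hf k).aestronglyMeasurable.aemeasurable.ennreal_ofReal
  have hlt : ∫⁻ ω, ∑' k, ENNReal.ofReal (f k ω) ∂P ≠ ⊤ := by
    rw [lintegral_tsum hm]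
    simp_rw [← fun k => ofReal_integral_eq_lintegral_ofReal (hf k) (.of_forall (h0 k))]
    exact hs.tsum_ofReal_ne_top
  have hsum : ∀ᵐ ω ∂P, Summable fun k => f k ω := by
    filter_upwards [ae_lt_top' (AEMeasurable.tsum hm) hlt] with ω hω
    have := ENNReal.summable_toReal hω.ne
    simpa only [ENNReal.toReal_ofReal (h0 _ ω)] using this
  refine ⟨hsum, ?_⟩
  refine (integrable_toReal_of_lintegral_ne_top (AEMeasurable.tsum hm) hlt).congr ?_
  filter_upwards [hsum] with ω hω
  rw [← ENNReal.ofReal_tsum_of_nonneg (fun k => h0 k ω) hω,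
    ENNReal.toReal_ofReal (tsum_nonneg fun k => h0 k ω)]

theorem sum_sq_sum_le_sq_sum {ι κ : Type*} [Fintype κ] (S : Finset ι) {a : ι → κ → ℝ} {b : ι → ℝ}
    (hb : ∀ s ∈ S, 0 ≤ b s) (h : ∀ s ∈ S, ∑ l, a s l ^ 2 ≤ b s ^ 2) :
    ∑ l, (∑ s ∈ S, a s l) ^ 2 ≤ (∑ s ∈ S, b s) ^ 2 := by
  have h1 : ∀ s ∈ S, ‖WithLp.toLp 2 (a s)‖ ≤ b s := fun s hs => by
    refine abs_le_of_sq_le_sq' ?_ (hb s hs) |>.2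
    rw [EuclideanSpace.real_norm_sq_eq]
    exact h s hs
  have h2 := (norm_sum_le S fun s => WithLp.toLp 2 (a s)).trans (Finset.sum_le_sum h1)
  have h3 := pow_le_pow_left₀ (norm_nonneg _) h2 2
  rw [EuclideanSpace.real_norm_sq_eq] at h3
  simpa using h3

theorem spectralNorm2_nonneg {p : ℕ} (A : Matrix (Fin p) (Fin p) ℝ) : 0 ≤ spectralNorm2 A :=
  norm_nonneg _

theorem sum_row_sq_le_spectralNorm2_sq {p : ℕ} (A : Matrix (Fin p) (Fin p) ℝ) (j : Fin p) :
    ∑ l, A j l ^ 2 ≤ spectralNorm2 A ^ 2 := by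
  set x : EuclideanSpace ℝ (Fin p) := WithLp.toLp 2 (A j) with hx
  have hxx : ‖x‖ ^ 2 = ∑ l, A j l ^ 2 := by rw [EuclideanSpace.real_norm_sq_eq]
  have h1 := (Matrix.toEuclideanCLM (n := Fin p) (𝕜 := ℝ) A).le_opNorm x
  have h2 := PiLp.norm_apply_le (Matrix.toEuclideanCLM (n := Fin p) (𝕜 := ℝ) A x) j
  have h3 : (Matrix.toEuclideanCLM (n := Fin p) (𝕜 := ℝ) A x) j = ‖x‖ ^ 2 := by
    rw [hxx, hx, Matrix.toEuclideanCLM_toLp]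
    simp [Matrix.mulVec, dotProduct, sq]
  rw [h3, Real.norm_of_nonneg (sq_nonneg _)] at h2
  have h4 : ‖x‖ ^ 2 ≤ spectralNorm2 A * ‖x‖ := h2.trans h1
  have h5 : ‖x‖ ≤ spectralNorm2 A := by
    rcases (norm_nonneg x).eq_or_lt with h | h
    · rw [← h]; exact spectralNorm2_nonneg A
    · nlinarith
  rw [← hxx]
  exact pow_le_pow_left₀ (norm_nonneg _) h5 2

theorem abs_apply_le_spectralNorm2 {p : ℕ} (A : Matrix (Fin p) (Fin p) ℝ) (j l : Fin p) :
    |A j l| ≤ spectralNorm2 A := by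
  refine abs_le_of_sq_le_sq (le_trans ?_ (sum_row_sq_le_spectralNorm2_sq A j))
    (spectralNorm2_nonneg A)
  exact Finset.single_le_sum (f := fun l => A j l ^ 2) (fun _ _ => sq_nonneg _) (Finset.mem_univ l)

/-- The weight with which the `l`-th coordinate of an innovation enters `∑ j, g j * |(A x) j|`. -/
def columnWeight {p : ℕ} (g : Fin p → ℝ) (A : Matrix (Fin p) (Fin p) ℝ) (l : Fin p) : ℝ :=
  ∑ j, g j * |A j l|

theorem sum_columnWeight_sq_le {p : ℕ} {g : Fin p → ℝ} (hg : ∀ j, 0 ≤ g j) (hg1 : ∑ j, g j = 1)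
    (A : Matrix (Fin p) (Fin p) ℝ) : ∑ l, columnWeight g A l ^ 2 ≤ spectralNorm2 A ^ 2 := by
  have h := sum_sq_sum_le_sq_sum Finset.univ (a := fun j l => g j * |A j l|)
    (b := fun j => g j * spectralNorm2 A)
    (fun j _ => mul_nonneg (hg j) (spectralNorm2_nonneg A)) (fun j _ => by
      simp only [mul_pow, sq_abs, ← Finset.mul_sum]
      exact mul_le_mul_of_nonneg_left (sum_row_sq_le_spectralNorm2_sq A j) (sq_nonneg _))
  rwa [← Finset.sum_mul, hg1, one_mul] at h

theorem sum_mul_abs_mulVec_le {p : ℕ} {g : Fin p → ℝ} (hg : ∀ j, 0 ≤ g j)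
    (A : Matrix (Fin p) (Fin p) ℝ) (x : Fin p → ℝ) :
    ∑ j, g j * |A.mulVec x j| ≤ ∑ l, columnWeight g A l * |x l| := by
  calc ∑ j, g j * |A.mulVec x j| ≤ ∑ j, g j * ∑ l, |A j l| * |x l| := by
        refine Finset.sum_le_sum fun j _ => mul_le_mul_of_nonneg_left ?_ (hg j)
        refine (Finset.abs_sum_le_sum_abs (fun l => A j l * x l) Finset.univ).trans ?_
        exact (Finset.sum_congr rfl fun l _ => abs_mul (A j l) (x l)).le
    _ = _ := by
        simp only [columnWeight, Finset.mul_sum, Finset.sum_mul]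
        rw [Finset.sum_comm]
        simp only [mul_assoc]

/-- Total weight received by time `t` when each time `1 ≤ i ≤ n` puts weight `f k` on the time
`i - k`, for `k < N`. -/
def timeSum (n N : ℕ) (f : ℕ → ℝ) (t : ℤ) : ℝ :=
  ∑ i ∈ Finset.Icc 1 n, ∑ k ∈ Finset.range N, if (i : ℤ) - k = t then f k else 0

theorem timeSum_nonneg {n N : ℕ} {f : ℕ → ℝ} (hf : ∀ k, 0 ≤ f k) (t : ℤ) : 0 ≤ timeSum n N f t :=
  Finset.sum_nonneg fun i _ => Finset.sum_nonneg fun k _ => by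
    split_ifs
    exacts [hf k, le_rfl]

theorem timeSum_le {n N : ℕ} {f : ℕ → ℝ} (hf : ∀ k, 0 ≤ f k) (t : ℤ) :
    timeSum n N f t ≤ ∑ k ∈ Finset.range N, f k := by
  rw [timeSum, Finset.sum_comm]
  refine Finset.sum_le_sum fun k _ => ?_
  rw [← Finset.sum_filter, Finset.sum_const, nsmul_eq_mul]
  have hc : (Finset.filter (fun i : ℕ => (i : ℤ) - k = t) (Finset.Icc 1 n)).card ≤ 1 := by
    refine Finset.card_le_one.mpr fun a ha b hb => ?_
    have h1 := (Finset.mem_filter.mp ha).2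
    have h2 := (Finset.mem_filter.mp hb).2
    omega
  have hc' : ((Finset.filter (fun i : ℕ => (i : ℤ) - k = t) (Finset.Icc 1 n)).card : ℝ) ≤ 1 := by
    exact_mod_cast hc
  exact mul_le_of_le_one_left (hf k) hc'

theorem sum_timeSum_mul (n N : ℕ) (f : ℕ → ℝ) (h : ℤ → ℝ) :
    ∑ t ∈ Finset.Icc (1 - N : ℤ) n, timeSum n N f t * h t
      = ∑ i ∈ Finset.Icc 1 n, ∑ k ∈ Finset.range N, f k * h (i - k) := by
  simp only [timeSum, Finset.sum_mul]
  rw [Finset.sum_comm]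
  refine Finset.sum_congr rfl fun i hi => ?_
  rw [Finset.sum_comm]
  refine Finset.sum_congr rfl fun k hk => ?_
  rw [Finset.mem_Icc] at hi
  rw [Finset.mem_range] at hk
  rw [Finset.sum_eq_single_of_mem ((i : ℤ) - k) (Finset.mem_Icc.mpr ⟨by omega, by omega⟩)]
  · simp
  · intro t _ ht
    rw [if_neg (Ne.symm ht), zero_mul]

theorem sum_timeSum_sq_le {n N : ℕ} {f : ℕ → ℝ} (hf : ∀ k, 0 ≤ f k) :
    ∑ t ∈ Finset.Icc (1 - N : ℤ) n, timeSum n N f t ^ 2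
      ≤ n * (∑ k ∈ Finset.range N, f k) ^ 2 := by
  calc ∑ t ∈ Finset.Icc (1 - N : ℤ) n, timeSum n N f t ^ 2
      ≤ ∑ t ∈ Finset.Icc (1 - N : ℤ) n, timeSum n N f t * ∑ k ∈ Finset.range N, f k := by
        refine Finset.sum_le_sum fun t _ => ?_
        rw [sq]
        exact mul_le_mul_of_nonneg_left (timeSum_le hf t) (timeSum_nonneg hf t)
    _ = _ := by
        rw [sum_timeSum_mul n N f fun _ => ∑ k ∈ Finset.range N, f k]
        simp only [← Finset.sum_mul, Finset.sum_const, Nat.card_Icc, nsmul_eq_mul,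
          Nat.add_sub_cancel]
        ring

theorem sum_timeSum_coord_sq_le {p n N : ℕ} {a : ℕ → Fin p → ℝ} {b : ℕ → ℝ} (hb : ∀ k, 0 ≤ b k)
    (h : ∀ k, ∑ l, a k l ^ 2 ≤ b k ^ 2) (t : ℤ) :
    ∑ l, timeSum n N (fun k => a k l) t ^ 2 ≤ timeSum n N b t ^ 2 := by
  simp only [timeSum]
  refine sum_sq_sum_le_sq_sum _
    (a := fun (i : ℕ) l => ∑ k ∈ Finset.range N, if (i : ℤ) - k = t then a k l else 0)
    (fun i _ => Finset.sum_nonneg fun k _ => by split_ifs; exacts [hb k, le_rfl]) fun i _ => ?_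
  refine sum_sq_sum_le_sq_sum _ (a := fun (k : ℕ) l => if (i : ℤ) - k = t then a k l else 0)
    (fun k _ => by split_ifs; exacts [hb k, le_rfl]) fun k _ => ?_
  split_ifs
  · exact h k
  · simp

theorem continuous_of_weightedLipschitz {p : ℕ} {G : (Fin p → ℝ) → ℝ} (hG : WeightedLipschitz G) :
    Continuous G := by
  obtain ⟨g, -, -, h⟩ := hG
  exact continuous_of_abs_sub_le_sum h

theorem abs_linearTerm_le {Ω : Type*} {p : ℕ} {A : ℕ → Matrix (Fin p) (Fin p) ℝ}
    {ε : ℤ → Fin p → Ω → ℝ} {b : ℕ → ℝ} (hA : ∀ k, spectralNorm2 (A k) ≤ b k)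
    (i : ℤ) (ω : Ω) (k : ℕ) (j : Fin p) :
    |linearTerm A ε i ω k j| ≤ b k * ∑ l, |ε (i - k) l ω| := by
  rw [Finset.mul_sum]
  refine (Finset.abs_sum_le_sum_abs (fun l => A k j l * ε (i - k) l ω) Finset.univ).trans ?_
  refine Finset.sum_le_sum fun l _ => ?_
  rw [abs_mul]
  exact mul_le_mul_of_nonneg_right ((abs_apply_le_spectralNorm2 _ _ _).trans (hA k)) (abs_nonneg _)

/-- The partial sum `∑ i ∈ [1, n], G X_i` with the moving averages truncated to lags `k < N`, as a
function of the array of innovations. -/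
noncomputable def truncatedSum {p : ℕ} (G : (Fin p → ℝ) → ℝ) (m : Fin p → ℝ)
    (A : ℕ → Matrix (Fin p) (Fin p) ℝ) (n N : ℕ) (y : ℤ × Fin p → ℝ) : ℝ :=
  ∑ i ∈ Finset.Icc 1 n, G (m + ∑ k ∈ Finset.range N, (A k).mulVec fun j => y ((i : ℤ) - k, j))

theorem abs_truncatedSum_sub_le {p : ℕ} {G : (Fin p → ℝ) → ℝ} {g : Fin p → ℝ}
    (hg : ∀ j, 0 ≤ g j) (hG : ∀ u v : Fin p → ℝ, |G u - G v| ≤ ∑ j, g j * |u j - v j|)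
    (m : Fin p → ℝ) (A : ℕ → Matrix (Fin p) (Fin p) ℝ) (n N : ℕ) (y y' : ℤ × Fin p → ℝ) :
    |truncatedSum G m A n N y - truncatedSum G m A n N y'| ≤
      ∑ q ∈ Finset.Icc (1 - N : ℤ) n ×ˢ Finset.univ,
        timeSum n N (fun k => columnWeight g (A k) q.2) q.1 * |y q - y' q| := by
  have hi : ∀ i : ℤ,
      |G (m + ∑ k ∈ Finset.range N, (A k).mulVec fun j => y (i - k, j)) -
        G (m + ∑ k ∈ Finset.range N, (A k).mulVec fun j => y' (i - k, j))| ≤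
      ∑ k ∈ Finset.range N, ∑ l, columnWeight g (A k) l * |y (i - k, l) - y' (i - k, l)| := by
    intro i
    refine (hG _ _).trans ?_
    calc _ ≤ ∑ j, g j * ∑ k ∈ Finset.range N,
          |(A k).mulVec (fun l => y (i - k, l) - y' (i - k, l)) j| := by
          refine Finset.sum_le_sum fun j _ => mul_le_mul_of_nonneg_left ?_ (hg j)
          refine le_trans (le_of_eq ?_) (Finset.abs_sum_le_sum_abs _ _)
          congr 1
          simp only [Pi.add_apply, Finset.sum_apply, add_sub_add_left_eq_sub,
            ← Finset.sum_sub_distrib]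
          refine Finset.sum_congr rfl fun k _ => ?_
          rw [← Pi.sub_apply, ← Matrix.mulVec_sub]
          rfl
      _ = ∑ k ∈ Finset.range N, ∑ j, g j *
          |(A k).mulVec (fun l => y (i - k, l) - y' (i - k, l)) j| := by
          simp only [Finset.mul_sum]
          exact Finset.sum_comm
      _ ≤ _ := Finset.sum_le_sum fun k _ => sum_mul_abs_mulVec_le hg _ _
  rw [truncatedSum, truncatedSum, ← Finset.sum_sub_distrib]
  refine (Finset.abs_sum_le_sum_abs _ _).trans ?_
  refine (Finset.sum_le_sum fun (i : ℕ) _ => hi i).trans (le_of_eq ?_)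
  rw [Finset.sum_product_right]
  simp only [fun l => sum_timeSum_mul n N (fun k => columnWeight g (A k) l)
    fun t => |y (t, l) - y' (t, l)|]
  refine Eq.trans (Finset.sum_congr rfl fun i _ => Finset.sum_comm) Finset.sum_comm

theorem lintegral_exp_truncatedSum_le {Ω : Type*} [MeasurableSpace Ω] {P : Measure Ω}
    [IsProbabilityMeasure P] {p : ℕ} {ε : ℤ → Fin p → Ω → ℝ} (hε : IIDInnovations P ε)
    {c θ B l : ℝ} (hc : 0 < c)
    (hint : ∀ i j, Integrable (fun ω => Real.exp (c * |ε i j ω|)) P)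
    (hθ : ∀ i j, ∫ ω, Real.exp (c * |ε i j ω|) ∂P = θ)
    {G : (Fin p → ℝ) → ℝ} (hG : WeightedLipschitz G) (m : Fin p → ℝ)
    {A : ℕ → Matrix (Fin p) (Fin p) ℝ} {b : ℕ → ℝ} (hA : ∀ k, spectralNorm2 (A k) ≤ b k)
    (n N : ℕ) (hB : ∑ k ∈ Finset.range N, b k ≤ B) (hl : 0 ≤ l) (hlB : l * B ≤ c / 2) :
    ∫⁻ ω, ENNReal.ofReal (Real.exp (l * (truncatedSum G m A n N (fun q => ε q.1 q.2 ω) -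
      ∫ ω', truncatedSum G m A n N (fun q => ε q.1 q.2 ω') ∂P))) ∂P ≤
      ENNReal.ofReal (Real.exp (8 * (θ / c) ^ 2 * (n * B ^ 2) * l ^ 2)) := by
  obtain ⟨g, hg, hg1, hGg⟩ := hG
  have hb : ∀ k, 0 ≤ b k := fun k => (spectralNorm2_nonneg _).trans (hA k)
  have hcw : ∀ k l, 0 ≤ columnWeight g (A k) l := fun k l =>
    Finset.sum_nonneg fun j _ => mul_nonneg (hg j) (abs_nonneg _)
  have hcs : ∀ k, ∑ l, columnWeight g (A k) l ^ 2 ≤ b k ^ 2 := fun k =>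
    (sum_columnWeight_sq_le hg hg1 _).trans (pow_le_pow_left₀ (spectralNorm2_nonneg _) (hA k) 2)
  have hS0 : 0 ≤ ∑ k ∈ Finset.range N, b k := Finset.sum_nonneg fun k _ => hb k
  have hB0 : 0 ≤ B := hS0.trans hB
  set L : ℤ × Fin p → ℝ := fun q => timeSum n N (fun k => columnWeight g (A k) q.2) q.1 with hL
  have hL0 : ∀ q, 0 ≤ L q := fun q => timeSum_nonneg (fun k => hcw k q.2) q.1
  have hLt : ∀ t, ∑ l, L (t, l) ^ 2 ≤ timeSum n N b t ^ 2 := sum_timeSum_coord_sq_le hb hcs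
  have hLB : ∀ q, L q ≤ B := fun q => by
    refine (abs_le_of_sq_le_sq' (le_trans ?_ (hLt q.1)) (timeSum_nonneg hb _)).2.trans
      ((timeSum_le hb _).trans hB)
    exact Finset.single_le_sum (f := fun l => L (q.1, l) ^ 2) (fun _ _ => sq_nonneg _)
      (Finset.mem_univ q.2)
  have hsum : ∑ q ∈ Finset.Icc (1 - N : ℤ) n ×ˢ Finset.univ, L q ^ 2 ≤ n * B ^ 2 := by
    rw [Finset.sum_product]
    refine (Finset.sum_le_sum fun t _ => hLt t).trans ((sum_timeSum_sq_le hb).trans ?_)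
    gcongr
  refine (lintegral_exp_lipschitz_indep_le (Y := fun q : ℤ × Fin p => ε q.1 q.2) (θ := θ)
    (fun q => hε.measurable _ _) hε.indep hc hl (fun q => hint _ _) (fun q => (hθ _ _).le)
    (Finset.Icc (1 - N : ℤ) n ×ˢ Finset.univ) hL0 (F := truncatedSum G m A n N)
    (abs_truncatedSum_sub_le hg hGg m A n N)
    (fun q => (mul_le_mul_of_nonneg_left (hLB q) hl).trans hlB)).2.2.trans ?_
  refine ENNReal.ofReal_le_ofReal (Real.exp_le_exp.mpr ?_)
  calc _ ≤ 8 * (θ / c) ^ 2 * l ^ 2 * (n * B ^ 2) := by gcongr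
    _ = _ := by ring

/-- The linear process is almost surely the limit of its truncations, with an integrable
dominating function. -/
theorem linearProcess_truncation {Ω : Type*} [MeasurableSpace Ω] {P : Measure Ω}
    [IsProbabilityMeasure P] {p : ℕ} {ε : ℤ → Fin p → Ω → ℝ} (hε : IIDInnovations P ε)
    (hint : ∀ i j, Integrable (fun ω => |ε i j ω|) P)
    {G : (Fin p → ℝ) → ℝ} (hG : WeightedLipschitz G) (m : Fin p → ℝ)
    {A : ℕ → Matrix (Fin p) (Fin p) ℝ} {b : ℕ → ℝ} (hA : ∀ k, spectralNorm2 (A k) ≤ b k)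
    (hbs : Summable b) (i : ℤ) :
    (∀ᵐ ω ∂P, Summable (linearTerm A ε i ω)) ∧
    Integrable (fun ω => G (linearProcess m A ε i ω)) P ∧
    (∀ N, Integrable (fun ω => G (m + ∑ k ∈ Finset.range N, linearTerm A ε i ω k)) P) ∧
    (∀ᵐ ω ∂P, Filter.Tendsto (fun N => G (m + ∑ k ∈ Finset.range N, linearTerm A ε i ω k))
      Filter.atTop (nhds (G (linearProcess m A ε i ω)))) ∧
    Filter.Tendsto (fun N => ∫ ω, G (m + ∑ k ∈ Finset.range N, linearTerm A ε i ω k) ∂P)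
      Filter.atTop (nhds (∫ ω, G (linearProcess m A ε i ω) ∂P)) := by
  have hGc := continuous_of_weightedLipschitz hG
  obtain ⟨g, hg, hg1, hGg⟩ := hG
  have hb : ∀ k, 0 ≤ b k := fun k => (spectralNorm2_nonneg _).trans (hA k)
  set r : ℕ → Ω → ℝ := fun k ω => b k * ∑ l, |ε (i - k) l ω| with hr
  have hr0 : ∀ k ω, 0 ≤ r k ω := fun k ω =>
    mul_nonneg (hb k) (Finset.sum_nonneg fun l _ => abs_nonneg _)
  have hri : ∀ k, Integrable (r k) P := fun k =>
    (integrable_finsetSum _ fun l _ => hint (i - k) l).const_mul _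
  have hrs : Summable fun k => ∫ ω, r k ω ∂P := by
    have e : ∀ k : ℕ, ∫ ω, r k ω ∂P = b k * ∑ l, ∫ ω, |ε 0 l ω| ∂P := fun k => by
      rw [hr]
      simp only
      rw [integral_const_mul, integral_finsetSum _ fun l _ => hint _ l]
      congr 1
      refine Finset.sum_congr rfl fun l _ => ?_
      exact ((hε.identDistrib (i - k) l 0 l).comp (u := fun x => |x|) (by fun_prop)).integral_eq
    simp only [e]
    exact hbs.mul_right _
  obtain ⟨hrsum, hRi⟩ := ae_summable_and_integrable_tsum_of_nonneg hri hr0 hrs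
  have hterm : ∀ ω, Summable (fun k => r k ω) → Summable (linearTerm A ε i ω) := fun ω hω =>
    Pi.summable.mpr fun j => .of_norm_bounded hω fun k => abs_linearTerm_le hA i ω k j
  have hlim : ∀ᵐ ω ∂P, Filter.Tendsto
      (fun N => G (m + ∑ k ∈ Finset.range N, linearTerm A ε i ω k))
      Filter.atTop (nhds (G (linearProcess m A ε i ω))) := by
    filter_upwards [hrsum] with ω hω
    exact (hGc.tendsto _).comp ((hterm ω hω).hasSum.tendsto_sum_nat.const_add m)
  have hmeas : ∀ N, Measurable fun ω => G (m + ∑ k ∈ Finset.range N, linearTerm A ε i ω k) := by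
    intro N
    refine hGc.measurable.comp (measurable_const.add (Finset.measurable_fun_sum _ fun k _ => ?_))
    refine measurable_pi_lambda _ fun j => ?_
    exact Finset.measurable_fun_sum Finset.univ
      fun l _ => (hε.measurable (i - k) l).const_mul (A k j l)
  have hbound : ∀ N, ∀ᵐ ω ∂P, ‖G (m + ∑ k ∈ Finset.range N, linearTerm A ε i ω k)‖ ≤
      |G m| + ∑' k, r k ω := by
    intro N
    filter_upwards [hrsum] with ω hω
    have h1 := hGg (m + ∑ k ∈ Finset.range N, linearTerm A ε i ω k) m
    have h2 := abs_sub_abs_le_abs_sub (G (m + ∑ k ∈ Finset.range N, linearTerm A ε i ω k)) (G m)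
    have h3 : ∑ j, g j * |(m + ∑ k ∈ Finset.range N, linearTerm A ε i ω k) j - m j| ≤
        ∑' k, r k ω := by
      calc _ ≤ ∑ j, g j * ∑' k, r k ω := by
            refine Finset.sum_le_sum fun j _ => mul_le_mul_of_nonneg_left ?_ (hg j)
            rw [Pi.add_apply, add_sub_cancel_left, Finset.sum_apply]
            refine (Finset.abs_sum_le_sum_abs _ _).trans ?_
            refine (Finset.sum_le_sum fun k _ => abs_linearTerm_le hA i ω k j).trans ?_
            exact hω.sum_le_tsum _ fun k _ => hr0 k ω
        _ = _ := by rw [← Finset.sum_mul, hg1, one_mul]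
    rw [Real.norm_eq_abs]
    linarith
  have hbi : Integrable (fun ω => |G m| + ∑' k, r k ω) P := (integrable_const _).add hRi
  have hmlim : AEStronglyMeasurable (fun ω => G (linearProcess m A ε i ω)) P :=
    aestronglyMeasurable_of_tendsto_ae _ (fun N => (hmeas N).aestronglyMeasurable) hlim
  refine ⟨hrsum.mono hterm, ?_, fun N => hbi.mono' (hmeas N).aestronglyMeasurable (hbound N),
    hlim, tendsto_integral_of_dominated_convergence _ (fun N => (hmeas N).aestronglyMeasurable)
      hbi hbound hlim⟩
  refine hbi.mono' hmlim ?_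
  filter_upwards [hlim, ae_all_iff.mpr hbound] with ω h1 h2
  exact le_of_tendsto' h1.norm h2

theorem one_sub_div_le_one_sub_rpow {ρ τ : ℝ} (h0 : 0 < ρ) (hτ : 1 ≤ τ) :
    (1 - ρ) / τ ≤ 1 - ρ ^ (1 / τ) := by
  have h := rpow_one_add_le_one_add_mul_self (s := ρ - 1) (p := 1 / τ) (by linarith)
    (by positivity) (by rw [div_le_one (by linarith)]; exact hτ)
  rw [add_sub_cancel] at h
  have e : (1 - ρ) / τ = -(1 / τ * (ρ - 1)) := by ring
  linarith

theorem theorem2p2 (ρ₀ c₀ : ℝ) (hρ₀ : 0 < ρ₀) (hρ₁ : ρ₀ < 1) (hc₀ : 0 < c₀) :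
    ∃ C₃ C₄ : ℝ, 0 < C₃ ∧ 0 < C₄ ∧
      ∀ {Ω : Type*} [MeasurableSpace Ω] (P : Measure Ω) [IsProbabilityMeasure P]
        (n p : ℕ) (m : Fin p → ℝ) (A : ℕ → Matrix (Fin p) (Fin p) ℝ)
        (ε : ℤ → Fin p → Ω → ℝ) (θ γ τ : ℝ) (G : (Fin p → ℝ) → ℝ),
        IIDInnovations P ε →
        (∀ i j, ∫ ω, ε i j ω ∂P = 0) →
        (∀ i j, Integrable (fun ω => Real.exp (c₀ * |ε i j ω|)) P) →
        (∀ i j, ∫ ω, Real.exp (c₀ * |ε i j ω|) ∂P = θ) →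
        A 0 = 1 →
        1 ≤ γ → 1 ≤ τ →
        (∀ k : ℕ, spectralNorm2 (A k) ≤ γ * ρ₀ ^ ((k : ℝ) / τ)) →
        WeightedLipschitz G →
        (∀ i : ℤ, ∀ᵐ ω ∂P, Summable (linearTerm A ε i ω)) ∧
        (∀ i : ℤ, Integrable (fun ω => G (linearProcess m A ε i ω)) P) ∧
        ∀ x : ℝ, 0 < x →
          P.real {ω | x ≤ ∑ i ∈ Finset.Icc 1 n,
              (G (linearProcess m A ε (i : ℤ) ω) - ∫ ω', G (linearProcess m A ε (i : ℤ) ω') ∂P)} ≤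
            2 * Real.exp (-(x ^ 2 / (C₃ * n * θ ^ 2 * τ ^ 2 * γ ^ 2 + C₄ * γ * τ * x))) := by
  have hρ : 0 < 1 - ρ₀ := by linarith
  refine ⟨32 / (c₀ ^ 2 * (1 - ρ₀) ^ 2), 4 / (c₀ * (1 - ρ₀)), by positivity, by positivity, ?_⟩
  intro Ω _ P _ n p m A ε θ γ τ G hε _ hint hθ _ hγ hτ hA hG
  have hγ0 : 0 < γ := by linarith
  have hτ0 : 0 < τ := by linarith
  set r := ρ₀ ^ (1 / τ) with hr
  have hr0 : 0 ≤ r := Real.rpow_nonneg hρ₀.le _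
  have hr1 : (1 - ρ₀) / τ ≤ 1 - r := one_sub_div_le_one_sub_rpow hρ₀ hτ
  have hr1' : 0 < 1 - r := lt_of_lt_of_le (by positivity) hr1
  have hA' : ∀ k, spectralNorm2 (A k) ≤ γ * r ^ k := fun k => by
    refine (hA k).trans (le_of_eq ?_)
    rw [hr, ← Real.rpow_mul_natCast hρ₀.le]
    ring_nf
  set B := γ * τ / (1 - ρ₀) with hB
  have hB0 : 0 < B := by positivity
  have hbs : Summable fun k : ℕ => γ * r ^ k :=
    (summable_geometric_of_lt_one hr0 (by linarith)).mul_left γ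
  have hbB : ∀ N, ∑ k ∈ Finset.range N, γ * r ^ k ≤ B := fun N => by
    refine (hbs.sum_le_tsum _ fun k _ => by positivity).trans ?_
    rw [tsum_mul_left, tsum_geometric_of_lt_one hr0 (by linarith), hB, mul_div_assoc]
    gcongr
    rw [inv_le_comm₀ hr1' (by positivity), inv_div]
    exact hr1
  have habs : ∀ i j, Integrable (fun ω => |ε i j ω|) P := fun i j =>
    integrable_abs_of_integrable_exp (hε.measurable i j).aestronglyMeasurable hc₀ (hint i j)
  have htr := linearProcess_truncation hε habs hG m hA' hbs
  refine ⟨fun i => (htr i).1, fun i => (htr i).2.1, fun x hx => ?_⟩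
  set S : ℕ → Ω → ℝ := fun N ω => truncatedSum G m A n N fun q => ε q.1 q.2 ω with hS
  have hSe : ∀ N ω, S N ω = ∑ i ∈ Finset.Icc 1 n,
      G (m + ∑ k ∈ Finset.range N, linearTerm A ε i ω k) := fun N ω => rfl
  have hSi : ∀ N, Integrable (S N) P := fun N =>
    integrable_finsetSum _ fun i _ => (htr i).2.2.1 N
  have hSint : ∀ N, ∫ ω, S N ω ∂P = ∑ i ∈ Finset.Icc 1 n,
      ∫ ω, G (m + ∑ k ∈ Finset.range N, linearTerm A ε i ω k) ∂P := fun N =>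
    integral_finsetSum _ fun i _ => (htr i).2.2.1 N
  set Z : Ω → ℝ := fun ω => ∑ i ∈ Finset.Icc 1 n,
    (G (linearProcess m A ε (i : ℤ) ω) - ∫ ω', G (linearProcess m A ε (i : ℤ) ω') ∂P) with hZ
  have hZm : AEMeasurable Z P := Finset.aemeasurable_fun_sum _ fun i _ =>
    ((htr i).2.1.aestronglyMeasurable.aemeasurable.sub_const _)
  have hlim : ∀ᵐ ω ∂P, Filter.Tendsto (fun N => S N ω - ∫ ω', S N ω' ∂P)
      Filter.atTop (nhds (Z ω)) := by
    filter_upwards [ae_all_iff.mpr fun i => (htr i).2.2.2.1] with ω hω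
    simp only [hSint]
    simp only [hSe, hZ, ← Finset.sum_sub_distrib]
    exact tendsto_finsetSum _ fun (i : ℕ) _ => (hω i).sub (htr i).2.2.2.2
  have hmgf : ∀ l, 0 ≤ l → l ≤ c₀ / (2 * B) → ∫⁻ ω, ENNReal.ofReal (Real.exp (l * Z ω)) ∂P ≤
      ENNReal.ofReal (Real.exp (8 * (θ / c₀) ^ 2 * (n * B ^ 2) * l ^ 2)) := by
    intro l hl hlb
    have hlB : l * B ≤ c₀ / 2 := by
      rw [le_div_iff₀ (by positivity)] at hlb
      linarith
    set f : ℕ → Ω → ENNReal := fun N ω =>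
      ENNReal.ofReal (Real.exp (l * (S N ω - ∫ ω', S N ω' ∂P))) with hf
    calc ∫⁻ ω, ENNReal.ofReal (Real.exp (l * Z ω)) ∂P
        ≤ ∫⁻ ω, Filter.liminf (fun N => f N ω) Filter.atTop ∂P := by
          refine lintegral_mono_ae ?_
          filter_upwards [hlim] with ω hω
          have hc : Continuous fun z : ℝ => ENNReal.ofReal (Real.exp (l * z)) :=
            ENNReal.continuous_ofReal.comp (by fun_prop)
          exact ((hc.tendsto _).comp hω).liminf_eq.ge
      _ ≤ Filter.liminf (fun N => ∫⁻ ω, f N ω ∂P) Filter.atTop := by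
          refine lintegral_liminf_le' fun N => ?_
          have := (hSi N).aestronglyMeasurable.aemeasurable
          fun_prop
      _ ≤ Filter.liminf (fun _ : ℕ => ENNReal.ofReal
            (Real.exp (8 * (θ / c₀) ^ 2 * (n * B ^ 2) * l ^ 2))) Filter.atTop := by
          refine Filter.liminf_le_liminf (.of_forall fun N => ?_)
          exact lintegral_exp_truncatedSum_le hε hc₀ hint hθ hG m hA' n N (hbB N) hl hlB
      _ = _ := by simp
  have hmain := measureReal_ge_le_exp_of_lintegral_exp_le hZm (by positivity)
    (b := c₀ / (2 * B)) (by positivity) hx hmgf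
  have e : 4 * (8 * (θ / c₀) ^ 2 * (n * B ^ 2)) + 2 * (x / (c₀ / (2 * B))) =
      32 / (c₀ ^ 2 * (1 - ρ₀) ^ 2) * n * θ ^ 2 * τ ^ 2 * γ ^ 2 +
        4 / (c₀ * (1 - ρ₀)) * γ * τ * x := by
    rw [hB]
    field_simp
    ring
  rw [e] at hmain
  refine hmain.trans ?_
  linarith [Real.exp_pos (-(x ^ 2 / (32 / (c₀ ^ 2 * (1 - ρ₀) ^ 2) * n * θ ^ 2 * τ ^ 2 * γ ^ 2 +
        4 / (c₀ * (1 - ρ₀)) * γ * τ * x)))]
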